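/- Let $q$ be an odd prime power, let $\mathbb{F}_q$ be the field with $q$ elements, and for $x=(x_1,\dots,x_d)\in\mathbb{F}_q^d$ put $\|x\|:=x_1^2+\cdots+x_d^2\in\mathbb{F}_q$. Let $k\ge 2$ be an integer, and for $r\in\mathbb{F}_q$ say that $\mathcal{E}\subseteq\mathbb{F}_q^d$ contains a pair of $k$-stars with dilation ratio $r$ if there exist distinct points $x_1,\dots,x_{k+1}\in\mathcal{E}$ and distinct points $y_1,\dots,y_{k+1}\in\mathcal{E}$ such that $$\|y_1-y_i\|=r\,\|x_1-x_i\|\neq 0\qquad\text{for } i=2,\dots,k+1 .$$ Let $\mathcal{E}\subseteq\mathbb{F}_q^d$. 1. If $q\ge 5$, $d\ge 2$ is even, $r\in\mathbb{F}_q\setminus\{0\}$ and $|\mathcal{E}|\ge\left(31+10\binom{k}{2}\right)q^{d/2}$, then $\mathcal{E}$ contains a pair of $k$-stars with dilation ratio $r$. 2. If $d\ge 3$ is odd, $r$ is a nonzero square in $\mathbb{F}_q$ and $|\mathcal{E}|\ge\left(4+\sqrt{3}\binom{k}{2}\right)q^{d/2}$, then $\mathcal{E}$ contains a pair of $k$-stars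 with dilation ratio $r$. -/

import Mathlib

/-- The quadratic form `‖x‖ = x₁² + ⋯ + x_d²` on `F ^ d` (with values in `F`). -/
def sqNorm {F : Type*} [Field F] {d : ℕ} (x : Fin d → F) : F :=
  ∑ i, x i ^ 2

/-- The set `E ⊆ F ^ d` contains a pair of copies of the graph `G` (on `n` vertices) with
dilation ratio `r`: there are distinct points `x₁, …, xₙ` of `E` and distinct points
`y₁, …, yₙ` of `E` with `‖yᵢ - yⱼ‖ = r ‖xᵢ - xⱼ‖ ≠ 0` for every edge `{i, j}` of `G`. -/
def ContainsPair {F : Type*} [Field F] {d n : ℕ} (E : Finset (Fin d → F))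
    (G : SimpleGraph (Fin n)) (r : F) : Prop :=
  ∃ x y : Fin n → (Fin d → F),
    Function.Injective x ∧ Function.Injective y ∧
    (∀ i, x i ∈ E) ∧ (∀ i, y i ∈ E) ∧
    ∀ i j, G.Adj i j →
      sqNorm (y i - y j) = r * sqNorm (x i - x j) ∧ r * sqNorm (x i - x j) ≠ 0

/-- The `k`-star: the graph on `k + 1` vertices in which the first vertex (here `0`) is joined to
every other vertex, and there are no other edges. -/
def kStar (k : ℕ) : SimpleGraph (Fin (k + 1)) :=
  SimpleGraph.starGraph 0

/-! Write `N` for the size of `E`, `ν(t)` for the number of ordered pairs of `E` at distance `t`,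
and `S = ∑_{t ≠ 0} ν(t) ν(r t)`. The proof compares a lower and an upper bound for `S`.

Lower bound, of order `N^4 / q`. Let `Z(t)` be the Fourier mass of `E` on the sphere of radius `t`.
Completing the square shows that the transform of `Z` at `a ≠ 0` is a `d`-th power of a Gauss sum
times the transform of `ν` at `-1/(4a)`. By Parseval, the deviation of `∑ ν(t) ν(r t)` from its mean
is then that of `∑ Z(t) Z(t/r)`, suitably scaled, provided the Gauss sums multiply to `q^d`; this
holds for even `d`, and for square `r`. Since `Z ≥ 0`, a lower bound follows
(`dilated_moment_identity`). The term `ν(0)^2` must still be removed: for odd `d` it is small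
enough, while for even `d` it can be large but is then offset by `Z(0)^2` (`dilatedCount_odd`,
`dilatedCount_even`).

Upper bound. For centres `x`, `y`, matching neighbours of `x` at distance `t` with neighbours of `y`
at distance `r t` yields `∑_t min` pairs of leaves. If this is always at most `k - 1`, then writing
each product of pinned counts as `min * max` and applying Cauchy-Schwarz bounds `S^2` by `(k-1)^2
N^2` times `2 N` times the number of isosceles triples (`dilatedCount_sq_le`, `sum_sq_pinCount_le`).
For `N` above the threshold this contradicts the lower bound. -/

open Finset

/-! ### Quadratic Gauss sums -/

section QuadraticGaussSum

variable {F : Type*} [Field F] [Fintype F]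

/-- The quadratic Gauss sum `∑ u, χ (s u²)`. -/
noncomputable def quadSum (χ : AddChar F ℂ) (s : F) : ℂ := ∑ u, χ (s * u ^ 2)

theorem two_ne_zero_of_odd_card (hq : Odd (Fintype.card F)) : (2 : F) ≠ 0 := by
  intro h
  have hc : ringChar F = 2 := (CharP.ringChar_of_prime_eq_zero Nat.prime_two (by exact_mod_cast h))
  have := FiniteField.even_card_of_char_two hc
  rw [Nat.odd_iff] at hq
  omega

theorem ringChar_ne_two {F : Type*} [Field F] (h2 : (2 : F) ≠ 0) : ringChar F ≠ 2 := by
  intro h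
  apply h2
  have := ringChar.Nat.cast_ringChar (R := F)
  rw [h] at this
  exact_mod_cast this

theorem card_sqrts_eq [DecidableEq F] (h2 : (2 : F) ≠ 0) (v : F) :
    ((#{u : F | u ^ 2 = v} : ℕ) : ℤ) = quadraticChar F v + 1 := by
  rw [← quadraticChar_card_sqrts (ringChar_ne_two h2) v]
  congr 2
  ext
  simp

theorem addChar_map_sum {A M ι : Type*} [AddCommMonoid A] [CommMonoid M] (χ : AddChar A M)
    (s : Finset ι) (f : ι → A) : χ (∑ i ∈ s, f i) = ∏ i ∈ s, χ (f i) := by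
  classical
  induction s using Finset.induction with
  | empty => simp
  | insert a s ha ih =>
    rw [Finset.sum_insert ha, Finset.prod_insert ha, AddChar.map_add_eq_mul, ih]

theorem sum_addChar_mul [DecidableEq F] {χ : AddChar F ℂ} (hχ : χ.IsPrimitive) (a : F) :
    ∑ s, χ (s * a) = if a = 0 then (Fintype.card F : ℂ) else 0 := by
  rw [AddChar.sum_mulShift a hχ]
  split_ifs <;> simp

theorem quadSum_zero (χ : AddChar F ℂ) : quadSum χ 0 = Fintype.card F := by
  simp [quadSum]

theorem quadSum_mul_sq (χ : AddChar F ℂ) (a : F) {c : F} (hc : c ≠ 0) :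
    quadSum χ (a * c ^ 2) = quadSum χ a := by
  unfold quadSum
  refine Fintype.sum_equiv (Equiv.mulLeft₀ c hc) _ _ fun u => ?_
  simp only [Equiv.mulLeft₀_apply]
  congr 1
  ring

/-- Completing the square. -/
theorem sum_addChar_quadratic (h2 : (2 : F) ≠ 0) (χ : AddChar F ℂ) {a : F} (ha : a ≠ 0) (b : F) :
    ∑ u, χ (a * u ^ 2 + u * b) = quadSum χ a * χ (-b ^ 2 / (4 * a)) := by
  unfold quadSum
  rw [Finset.sum_mul]
  refine Fintype.sum_equiv (Equiv.addRight (b / (2 * a))) _ _ fun u => ?_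
  rw [← AddChar.map_add_eq_mul]
  congr 1
  have h4 : (4 : F) ≠ 0 := by
    have : (4 : F) = 2 * 2 := by norm_num
    rw [this]; exact mul_ne_zero h2 h2
  simp only [Equiv.coe_addRight]
  field_simp
  ring

/-- With `w = u - v`, `s u² - s v² = s w² + 2 s v w` is linear in `v`, so summing over `v` leaves
only `w = 0`. -/
theorem quadSum_mul_quadSum_neg (h2 : (2 : F) ≠ 0) {χ : AddChar F ℂ} (hχ : χ.IsPrimitive)
    {s : F} (hs : s ≠ 0) : quadSum χ s * quadSum χ (-s) = Fintype.card F := by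
  classical
  have h1 : quadSum χ s * quadSum χ (-s) = ∑ v, ∑ w, χ (s * w ^ 2) * χ (v * (2 * s * w)) := by
    unfold quadSum
    rw [Finset.sum_mul_sum, Finset.sum_comm]
    refine Finset.sum_congr rfl fun v _ => ?_
    refine Fintype.sum_equiv (Equiv.subRight v) _ _ fun u => ?_
    rw [← AddChar.map_add_eq_mul, ← AddChar.map_add_eq_mul]
    congr 1
    simp only [Equiv.subRight_apply]
    ring
  rw [h1, Finset.sum_comm]
  simp_rw [← Finset.mul_sum, sum_addChar_mul hχ]
  simp [h2, hs]

/-- Since `v` has `η(v) + 1` square roots, `η` the quadratic character, this is the Gauss sum of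
`η`, and `ε = η(-1)`. The point is that one sign serves every `s`: even powers of `quadSum` are
constant on nonzero `s`. -/
theorem exists_quadSum_sq (h2 : (2 : F) ≠ 0) {χ : AddChar F ℂ} (hχ : χ.IsPrimitive) :
    ∃ ε : ℝ, (ε = 1 ∨ ε = -1) ∧
      ∀ s : F, s ≠ 0 → quadSum χ s ^ 2 = (ε : ℂ) * Fintype.card F := by
  classical
  have hF := ringChar_ne_two h2
  refine ⟨((quadraticChar F (-1) : ℤ) : ℝ), ?_, fun s hs => ?_⟩
  · rcases quadraticChar_dichotomy (F := F) (a := -1) (by simp) with h | h <;> simp [h]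
  set η : MulChar F ℂ := (quadraticChar F).ringHomComp (Int.castRingHom ℂ) with hη
  have hη1 : η ≠ 1 := by
    intro h
    apply quadraticChar_ne_one hF
    exact MulChar.injective_ringHomComp (f := Int.castRingHom ℂ)
      (RingHom.injective_int _) (by change η = _; rw [h]; simp)
  have hη2 : η.IsQuadratic := (quadraticChar_isQuadratic F).comp _
  have hp : (χ.mulShift s).IsPrimitive := by
    intro a ha
    rw [AddChar.mulShift_mulShift]
    exact hχ (mul_ne_zero hs ha)
  have hg : quadSum χ s = gaussSum η (χ.mulShift s) := by
    have h0 : ∑ v, χ (s * v) = 0 := by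
      simp_rw [mul_comm s]
      rw [sum_addChar_mul hχ, if_neg hs]
    have h3 : quadSum χ s = ∑ v, (η v + 1) * χ (s * v) := by
      unfold quadSum
      rw [← Finset.sum_fiberwise univ (fun u : F => u ^ 2)]
      refine Finset.sum_congr rfl fun v _ => ?_
      have h5 : ((#{u : F | u ^ 2 = v} : ℕ) : ℂ) = η v + 1 := by
        have h4 := card_sqrts_eq h2 v
        simp only [hη, MulChar.ringHomComp_apply, eq_intCast]
        exact_mod_cast h4
      rw [← h5, Finset.sum_congr rfl (g := fun _ => χ (s * v))]
      · simp
      · intro u hu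
        rw [(Finset.mem_filter.1 hu).2]
    rw [h3]
    simp_rw [add_mul, one_mul, Finset.sum_add_distrib, h0, add_zero]
    rfl
  rw [hg, gaussSum_sq hη1 hη2 hp]
  simp [hη]

end QuadraticGaussSum

/-! ### Fourier transform on the field of distances -/

section CharTransform

variable {F : Type*} [Field F] [Fintype F]

/-- The Fourier transform of a real function on a finite field. -/
noncomputable def charTransform (χ : AddChar F ℂ) (f : F → ℝ) (s : F) : ℂ :=
  ∑ t, (f t : ℂ) * χ (s * t)

theorem charTransform_zero (χ : AddChar F ℂ) (f : F → ℝ) :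
    charTransform χ f 0 = ((∑ t, f t : ℝ) : ℂ) := by
  simp [charTransform]

theorem charTransform_fiber [DecidableEq F] {ι : Type*} (χ : AddChar F ℂ) (S : Finset ι)
    (g : ι → F) (w : ι → ℝ) (s : F) :
    charTransform χ (fun t => ∑ i ∈ S with g i = t, w i) s = ∑ i ∈ S, (w i : ℂ) * χ (s * g i) := by
  unfold charTransform
  rw [← Finset.sum_fiberwise S g]
  refine Finset.sum_congr rfl fun t _ => ?_
  push_cast
  rw [Finset.sum_mul]
  refine Finset.sum_congr rfl fun i hi => ?_
  rw [(Finset.mem_filter.1 hi).2]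

/-- Parseval's identity with a dilation. -/
theorem sum_charTransform_mul {χ : AddChar F ℂ} (hχ : χ.IsPrimitive) (f : F → ℝ) (r : F) :
    ∑ s, charTransform χ f (r * s) * charTransform χ f (-s) =
      Fintype.card F * ((∑ t, f t * f (r * t) : ℝ) : ℂ) := by
  classical
  have h1 : ∀ s, charTransform χ f (r * s) * charTransform χ f (-s) =
      ∑ t, ∑ t', (f t : ℂ) * f t' * χ (s * (r * t - t')) := by
    intro s
    unfold charTransform
    rw [Finset.sum_mul_sum]
    refine Finset.sum_congr rfl fun t _ => Finset.sum_congr rfl fun t' _ => ?_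
    rw [mul_mul_mul_comm, ← AddChar.map_add_eq_mul]
    congr 2
    ring
  simp_rw [h1]
  rw [Finset.sum_comm]
  push_cast
  rw [Finset.mul_sum]
  refine Finset.sum_congr rfl fun t _ => ?_
  rw [Finset.sum_comm]
  simp_rw [← Finset.mul_sum, sum_addChar_mul hχ, sub_eq_zero]
  simp
  ring

theorem sum_charTransform {χ : AddChar F ℂ} (hχ : χ.IsPrimitive) (f : F → ℝ) :
    ∑ s, charTransform χ f s = Fintype.card F * (f 0 : ℂ) := by
  classical
  unfold charTransform
  rw [Finset.sum_comm]
  simp_rw [← Finset.mul_sum, sum_addChar_mul hχ]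
  simp [mul_comm]

end CharTransform

/-! ### Distance counts, spherical Fourier mass and isosceles triples -/

section Distances

variable {F : Type*} [Field F] [Fintype F] [DecidableEq F] {d : ℕ}

/-- The number of points of `E` at distance `t` from `x`. -/
def pinCount (E : Finset (Fin d → F)) (x : Fin d → F) (t : F) : ℕ :=
  #{y ∈ E | sqNorm (x - y) = t}

/-- The number of ordered pairs of points of `E` at distance `t`. -/
def distCount (E : Finset (Fin d → F)) (t : F) : ℝ := ∑ x ∈ E, (pinCount E x t : ℝ)

/-- The Fourier transform of the indicator function of `E`. -/
noncomputable def indicatorTransform (χ : AddChar F ℂ) (E : Finset (Fin d → F))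
    (m : Fin d → F) : ℂ := ∑ x ∈ E, χ (m ⬝ᵥ x)

/-- The Fourier mass of `E` on the sphere of radius `t`. -/
noncomputable def sphereMass (χ : AddChar F ℂ) (E : Finset (Fin d → F)) (t : F) : ℝ :=
  ∑ m with sqNorm m = t, Complex.normSq (indicatorTransform χ E m)

theorem distCount_nonneg {F : Type*} [Field F] [DecidableEq F] {d : ℕ} (E : Finset (Fin d → F)) (t : F) : 0 ≤ distCount E t :=
  Finset.sum_nonneg fun _ _ => Nat.cast_nonneg _

theorem sphereMass_nonneg (χ : AddChar F ℂ) (E : Finset (Fin d → F)) (t : F) :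
    0 ≤ sphereMass χ E t :=
  Finset.sum_nonneg fun _ _ => Complex.normSq_nonneg _

theorem charTransform_pinCount (χ : AddChar F ℂ) (E : Finset (Fin d → F)) (x : Fin d → F) (s : F) :
    charTransform χ (fun t => (pinCount E x t : ℝ)) s = ∑ y ∈ E, χ (s * sqNorm (x - y)) := by
  have h : (fun t => (pinCount E x t : ℝ)) =
      fun t => ∑ y ∈ E with sqNorm (x - y) = t, (1 : ℝ) := by
    funext t
    simp [pinCount]
  rw [h, charTransform_fiber]
  simp

theorem charTransform_distCount (χ : AddChar F ℂ) (E : Finset (Fin d → F)) (s : F) :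
    charTransform χ (distCount E) s = ∑ x ∈ E, ∑ y ∈ E, χ (s * sqNorm (x - y)) := by
  simp_rw [← charTransform_pinCount]
  unfold charTransform distCount
  rw [Finset.sum_comm]
  refine Finset.sum_congr rfl fun t _ => ?_
  push_cast
  rw [Finset.sum_mul]

theorem charTransform_distCount_zero (χ : AddChar F ℂ) (E : Finset (Fin d → F)) :
    charTransform χ (distCount E) 0 = (#E : ℂ) ^ 2 := by
  rw [charTransform_distCount]
  simp [sq]

theorem sum_addChar_dotProduct {χ : AddChar F ℂ} (hχ : χ.IsPrimitive) (w : Fin d → F) :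
    ∑ m : Fin d → F, χ (m ⬝ᵥ w) = if w = 0 then (Fintype.card F : ℂ) ^ d else 0 := by
  have h : ∀ m : Fin d → F, χ (m ⬝ᵥ w) = ∏ i, χ (m i * w i) := fun m => by
    rw [dotProduct, addChar_map_sum]
  simp_rw [h]
  rw [← Fintype.prod_sum (fun i (u : F) => χ (u * w i))]
  simp_rw [sum_addChar_mul hχ]
  split_ifs with hw
  · simp [hw]
  · obtain ⟨i, hi⟩ := Function.ne_iff.1 hw
    exact Finset.prod_eq_zero (Finset.mem_univ i) (if_neg hi)

theorem sum_addChar_sqNorm {F : Type*} [Field F] [Fintype F] {d : ℕ} (h2 : (2 : F) ≠ 0) (χ : AddChar F ℂ) {a : F} (ha : a ≠ 0)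
    (w : Fin d → F) :
    ∑ m : Fin d → F, χ (a * sqNorm m + m ⬝ᵥ w) =
      quadSum χ a ^ d * χ (-(4 * a)⁻¹ * sqNorm w) := by
  have h : ∀ m : Fin d → F, χ (a * sqNorm m + m ⬝ᵥ w) = ∏ i, χ (a * m i ^ 2 + m i * w i) :=
    fun m => by
      rw [dotProduct, sqNorm, Finset.mul_sum, ← Finset.sum_add_distrib, addChar_map_sum]
  simp_rw [h]
  rw [← Fintype.prod_sum (fun i (u : F) => χ (a * u ^ 2 + u * w i))]
  simp_rw [sum_addChar_quadratic h2 χ ha]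
  rw [Finset.prod_mul_distrib, ← addChar_map_sum, sqNorm, Finset.mul_sum]
  simp only [Finset.prod_const, Finset.card_univ, Fintype.card_fin]
  congr 2
  refine Finset.sum_congr rfl fun i _ => ?_
  rw [div_eq_mul_inv]
  ring

theorem charTransform_sphereMass (χ : AddChar F ℂ) (E : Finset (Fin d → F)) (a : F) :
    charTransform χ (sphereMass χ E) a =
      ∑ x ∈ E, ∑ y ∈ E, ∑ m : Fin d → F, χ (a * sqNorm m + m ⬝ᵥ (x - y)) := by
  unfold sphereMass
  rw [charTransform_fiber]
  have h : ∀ m : Fin d → F, (Complex.normSq (indicatorTransform χ E m) : ℂ) * χ (a * sqNorm m) =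
      ∑ x ∈ E, ∑ y ∈ E, χ (a * sqNorm m + m ⬝ᵥ (x - y)) := by
    intro m
    rw [← Complex.mul_conj, indicatorTransform, map_sum, Finset.sum_mul_sum, Finset.sum_mul]
    refine Finset.sum_congr rfl fun x _ => ?_
    rw [Finset.sum_mul]
    refine Finset.sum_congr rfl fun y _ => ?_
    rw [← AddChar.map_neg_eq_conj, ← AddChar.map_add_eq_mul, ← AddChar.map_add_eq_mul,
      dotProduct_sub]
    congr 1
    ring
  simp_rw [h]
  rw [Finset.sum_comm]
  refine Finset.sum_congr rfl fun x _ => ?_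
  rw [Finset.sum_comm]

theorem charTransform_sphereMass_zero {χ : AddChar F ℂ} (hχ : χ.IsPrimitive)
    (E : Finset (Fin d → F)) :
    charTransform χ (sphereMass χ E) 0 = (Fintype.card F : ℂ) ^ d * #E := by
  rw [charTransform_sphereMass]
  simp_rw [zero_mul, zero_add, sum_addChar_dotProduct hχ, sub_eq_zero]
  simp [mul_comm]

theorem sum_sphereMass {χ : AddChar F ℂ} (hχ : χ.IsPrimitive) (E : Finset (Fin d → F)) :
    ∑ t, sphereMass χ E t = (Fintype.card F : ℝ) ^ d * #E := by
  have h := charTransform_sphereMass_zero hχ E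
  rw [charTransform_zero] at h
  exact_mod_cast h

/-- The duality behind the lower bound: a Gaussian in the frequency `m` transforms into a Gaussian
in `x - y` with inverted parameter. -/
theorem charTransform_sphereMass_of_ne_zero (h2 : (2 : F) ≠ 0) (χ : AddChar F ℂ)
    (E : Finset (Fin d → F)) {a : F} (ha : a ≠ 0) :
    charTransform χ (sphereMass χ E) a =
      quadSum χ a ^ d * charTransform χ (distCount E) (-(4 * a)⁻¹) := by
  rw [charTransform_sphereMass, charTransform_distCount, Finset.mul_sum]
  refine Finset.sum_congr rfl fun x _ => ?_
  rw [Finset.mul_sum]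
  exact Finset.sum_congr rfl fun y _ => sum_addChar_sqNorm h2 χ ha _

/-- The number of isosceles triples in `E`. -/
theorem sum_sq_pinCount_le (h2 : (2 : F) ≠ 0) {χ : AddChar F ℂ} (hχ : χ.IsPrimitive)
    (E : Finset (Fin d → F)) :
    (Fintype.card F : ℝ) * ∑ x ∈ E, ∑ t, (pinCount E x t : ℝ) ^ 2 ≤
      (#E : ℝ) ^ 3 + (Fintype.card F : ℝ) * ((Fintype.card F : ℝ) ^ d * #E) := by
  set q := (Fintype.card F : ℝ) with hq
  let g : F → (Fin d → F) → ℂ := fun s x => ∑ y ∈ E, χ (s * sqNorm (x - y))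
  have hpars : ∀ x, q * ∑ t, (pinCount E x t : ℝ) ^ 2 = ∑ s, Complex.normSq (g s x) := by
    intro x
    have h := sum_charTransform_mul hχ (fun t => (pinCount E x t : ℝ)) 1
    simp_rw [one_mul, charTransform_pinCount, ← sq] at h
    have h' : ∀ s, (∑ y ∈ E, χ (s * sqNorm (x - y))) * ∑ y ∈ E, χ (-s * sqNorm (x - y)) =
        (Complex.normSq (g s x) : ℂ) := by
      intro s
      rw [← Complex.mul_conj, map_sum]
      congr 1
      refine Finset.sum_congr rfl fun y _ => ?_
      rw [← AddChar.map_neg_eq_conj, neg_mul]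
    simp_rw [h'] at h
    apply Complex.ofReal_injective
    rw [hq]
    push_cast
    push_cast at h
    exact h.symm
  -- With the centre ranging over the whole space, `‖x - y‖ - ‖x - z‖` is affine in `x`, so
  -- orthogonality leaves only `y = z`.
  have hfull : ∀ s, s ≠ 0 → ∑ x, Complex.normSq (g s x) = q ^ d * #E := by
    intro s hs
    have h : ∀ x, (Complex.normSq (g s x) : ℂ) =
        ∑ y ∈ E, ∑ z ∈ E, χ (s * (sqNorm y - sqNorm z)) * χ (x ⬝ᵥ ((2 * s) • (z - y))) := by
      intro x
      rw [← Complex.mul_conj, map_sum, Finset.sum_mul_sum]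
      refine Finset.sum_congr rfl fun y _ => Finset.sum_congr rfl fun z _ => ?_
      rw [← AddChar.map_neg_eq_conj, ← AddChar.map_add_eq_mul, ← AddChar.map_add_eq_mul]
      congr 1
      simp only [sqNorm, dotProduct, Finset.mul_sum, ← Finset.sum_sub_distrib,
        ← Finset.sum_add_distrib, ← Finset.sum_neg_distrib, Pi.smul_apply, Pi.sub_apply,
        smul_eq_mul]
      refine Finset.sum_congr rfl fun i _ => ?_
      ring
    have h' : (∑ x, (Complex.normSq (g s x) : ℂ)) = (q : ℂ) ^ d * #E := by
      simp_rw [h]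
      rw [Finset.sum_comm]
      have : ∀ y ∈ E, ∑ x : Fin d → F, ∑ z ∈ E,
          χ (s * (sqNorm y - sqNorm z)) * χ (x ⬝ᵥ ((2 * s) • (z - y))) = (q : ℂ) ^ d := by
        intro y hy
        rw [Finset.sum_comm]
        simp_rw [← Finset.mul_sum, sum_addChar_dotProduct hχ]
        simp [h2, hs, sub_eq_zero, hy, hq]
      rw [Finset.sum_congr rfl this]
      simp [mul_comm]
    exact_mod_cast h'
  rw [Finset.mul_sum]
  simp_rw [hpars]
  rw [Finset.sum_comm, ← Finset.add_sum_erase _ _ (Finset.mem_univ (0 : F))]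
  refine add_le_add ?_ ?_
  · simp [g]
    exact le_of_eq (by ring)
  · calc ∑ s ∈ univ.erase 0, ∑ x ∈ E, Complex.normSq (g s x)
        ≤ ∑ s ∈ (univ : Finset F).erase 0, q ^ d * #E := by
          refine Finset.sum_le_sum fun s hs => ?_
          rw [← hfull s (Finset.ne_of_mem_erase hs)]
          exact Finset.sum_le_univ_sum_of_nonneg fun _ => Complex.normSq_nonneg _
      _ ≤ ∑ s : F, q ^ d * #E :=
          Finset.sum_le_sum_of_subset_of_nonneg (Finset.erase_subset _ _)
            fun _ _ _ => by positivity
      _ = q * (q ^ d * #E) := by simp [hq]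

end Distances

/-! ### Lower bound for the dilated second moment -/

section SecondMoment

variable {F : Type*} [Field F] [Fintype F] [DecidableEq F] {d : ℕ}

theorem neg_four_mul_inv_involutive {F : Type*} [Field F] (h2 : (2 : F) ≠ 0) :
    Function.Involutive fun s : F => -(4 * s)⁻¹ := by
  intro s
  have h4 : (4 : F) ≠ 0 := by
    have : (4 : F) = 2 * 2 := by norm_num
    rw [this]; exact mul_ne_zero h2 h2
  rcases eq_or_ne s 0 with rfl | hs
  · simp
  · field_simp

/-- Reindexing a sum over the nonzero elements by `s ↦ -1 / (4 s)`. -/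
theorem sum_erase_zero_neg_four_mul_inv {M : Type*} [AddCommMonoid M] (h2 : (2 : F) ≠ 0)
    (f : F → M) :
    ∑ s ∈ univ.erase (0 : F), f (-(4 * s)⁻¹) = ∑ s ∈ univ.erase (0 : F), f s := by
  have h4 : (4 : F) ≠ 0 := by
    have : (4 : F) = 2 * 2 := by norm_num
    rw [this]; exact mul_ne_zero h2 h2
  refine Finset.sum_equiv (neg_four_mul_inv_involutive h2).toPerm (fun s => ?_) (fun s _ => rfl)
  simp [h4]

/-- Both sides are Parseval sums without their `s = 0` term. The duality matches them termwise under
`s ↦ -1/(4s)`, with `hγ` absorbing the Gauss sums. -/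
theorem dilated_moment_identity (h2 : (2 : F) ≠ 0) {χ : AddChar F ℂ} (hχ : χ.IsPrimitive)
    (E : Finset (Fin d → F)) {r : F} (hr : r ≠ 0)
    (hγ : ∀ s, s ≠ 0 → quadSum χ (r⁻¹ * s) ^ d * quadSum χ (-s) ^ d = (Fintype.card F : ℂ) ^ d) :
    (Fintype.card F : ℝ) * ∑ t, sphereMass χ E t * sphereMass χ E (r⁻¹ * t) -
        ((Fintype.card F : ℝ) ^ d * #E) ^ 2 =
      (Fintype.card F : ℝ) ^ d *
        ((Fintype.card F : ℝ) * ∑ t, distCount E t * distCount E (r * t) - (#E : ℝ) ^ 4) := by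
  have hZ := sum_charTransform_mul hχ (sphereMass χ E) r⁻¹
  have hν := sum_charTransform_mul hχ (distCount E) r
  rw [← Finset.add_sum_erase _ _ (Finset.mem_univ (0 : F))] at hZ hν
  simp only [mul_zero, neg_zero, charTransform_sphereMass_zero hχ,
    charTransform_distCount_zero] at hZ hν
  have key : ∑ s ∈ univ.erase (0 : F),
        charTransform χ (sphereMass χ E) (r⁻¹ * s) * charTransform χ (sphereMass χ E) (-s) =
      (Fintype.card F : ℂ) ^ d * ∑ s ∈ univ.erase (0 : F),
        charTransform χ (distCount E) (r * s) * charTransform χ (distCount E) (-s) := by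
    rw [← sum_erase_zero_neg_four_mul_inv h2 (fun s =>
      charTransform χ (distCount E) (r * s) * charTransform χ (distCount E) (-s)), Finset.mul_sum]
    refine Finset.sum_congr rfl fun s hs => ?_
    have hs0 := Finset.ne_of_mem_erase hs
    rw [charTransform_sphereMass_of_ne_zero h2 χ E (mul_ne_zero (inv_ne_zero hr) hs0),
      charTransform_sphereMass_of_ne_zero h2 χ E (neg_ne_zero.2 hs0), mul_mul_mul_comm,
      hγ s hs0]
    congr 3
    · rw [mul_inv, mul_inv, mul_inv, inv_inv]
      ring
    · rw [mul_neg, inv_neg]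
  have hfin : (Fintype.card F : ℂ) *
      ((∑ t, sphereMass χ E t * sphereMass χ E (r⁻¹ * t) : ℝ) : ℂ) -
        ((Fintype.card F : ℂ) ^ d * #E) ^ 2 =
      (Fintype.card F : ℂ) ^ d *
        ((Fintype.card F : ℂ) * ((∑ t, distCount E t * distCount E (r * t) : ℝ) : ℂ)
          - (#E : ℂ) ^ 4) := by
    rw [← hZ, ← hν, key]
    ring
  exact_mod_cast hfin

theorem distCount_zero_even (h2 : (2 : F) ≠ 0) {χ : AddChar F ℂ} (hχ : χ.IsPrimitive)
    (E : Finset (Fin d → F)) {κ : ℝ} (hκ : ∀ s : F, s ≠ 0 → quadSum χ s ^ d = κ) :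
    (Fintype.card F : ℝ) * sphereMass χ E 0 - (Fintype.card F : ℝ) ^ d * #E =
      κ * ((Fintype.card F : ℝ) * distCount E 0 - (#E : ℝ) ^ 2) := by
  have hZ := sum_charTransform hχ (sphereMass χ E)
  have hν := sum_charTransform hχ (distCount E)
  rw [← Finset.add_sum_erase _ _ (Finset.mem_univ (0 : F))] at hZ hν
  rw [charTransform_sphereMass_zero hχ] at hZ
  rw [charTransform_distCount_zero] at hν
  have key : ∑ s ∈ univ.erase (0 : F), charTransform χ (sphereMass χ E) s =
      (κ : ℂ) * ∑ s ∈ univ.erase (0 : F), charTransform χ (distCount E) s := by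
    rw [← sum_erase_zero_neg_four_mul_inv h2 (charTransform χ (distCount E)), Finset.mul_sum]
    refine Finset.sum_congr rfl fun s hs => ?_
    have hs0 := Finset.ne_of_mem_erase hs
    rw [charTransform_sphereMass_of_ne_zero h2 χ E hs0, hκ s hs0]
  have hfin : (Fintype.card F : ℂ) * (sphereMass χ E 0 : ℂ) - (Fintype.card F : ℂ) ^ d * #E =
      (κ : ℂ) * ((Fintype.card F : ℂ) * (distCount E 0 : ℂ) - (#E : ℂ) ^ 2) := by
    rw [← hZ, ← hν, add_sub_cancel_left, add_sub_cancel_left, key]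
  exact_mod_cast hfin

/-- The full sum counts square roots of `t`; dropping `s = 0` removes the `+ 1`. -/
theorem sum_quadSum_mul_addChar (h2 : (2 : F) ≠ 0) {χ : AddChar F ℂ} (hχ : χ.IsPrimitive) (t : F) :
    ∑ s ∈ univ.erase (0 : F), quadSum χ (-s) * χ (s * t) =
      (Fintype.card F : ℂ) * ((quadraticChar F t : ℤ) : ℂ) := by
  have h1 : ∑ s, quadSum χ (-s) * χ (s * t) =
      (Fintype.card F : ℂ) * (((quadraticChar F t : ℤ) : ℂ) + 1) := by
    have h3 : ((#{u : F | u ^ 2 = t} : ℕ) : ℂ) = ((quadraticChar F t : ℤ) : ℂ) + 1 := by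
      exact_mod_cast card_sqrts_eq h2 t
    have h4 : ∀ s, quadSum χ (-s) * χ (s * t) = ∑ u, χ (s * (t - u ^ 2)) := by
      intro s
      rw [quadSum, Finset.sum_mul]
      refine Finset.sum_congr rfl fun u _ => ?_
      rw [← AddChar.map_add_eq_mul]
      congr 1
      ring
    simp_rw [h4]
    rw [Finset.sum_comm, ← h3]
    simp_rw [sum_addChar_mul hχ, sub_eq_zero, eq_comm (a := t)]
    simp [Finset.sum_ite, mul_comm]
  rw [← Finset.add_sum_erase _ _ (Finset.mem_univ (0 : F))] at h1
  rw [neg_zero, quadSum_zero, zero_mul, AddChar.map_zero_eq_one] at h1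
  linear_combination h1

theorem distCount_zero_odd (h2 : (2 : F) ≠ 0) {χ : AddChar F ℂ} (hχ : χ.IsPrimitive) {e : ℕ}
    (E : Finset (Fin (2 * e + 1) → F)) :
    (Fintype.card F : ℝ) * distCount E 0 ≤
      (#E : ℝ) ^ 2 + (Fintype.card F : ℝ) ^ (e + 1) * #E := by
  obtain ⟨ε, hε, hsq⟩ := exists_quadSum_sq h2 hχ
  set q := (Fintype.card F : ℝ) with hq
  have hq0 : 0 < q := by
    rw [hq]; exact_mod_cast Fintype.card_pos
  have hν := sum_charTransform hχ (distCount E)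
  rw [← Finset.add_sum_erase _ _ (Finset.mem_univ (0 : F)), charTransform_distCount_zero] at hν
  -- Multiplying the duality by `quadSum χ (-s) ^ (2e + 1)` clears the Gauss sum on one side; on the
  -- other, all but one factor pair off into powers of `ε q`.
  have key : (q : ℂ) ^ (2 * e + 1) * ∑ s ∈ univ.erase (0 : F), charTransform χ (distCount E) s =
      ((ε : ℂ) * q) ^ e * ∑ s ∈ univ.erase (0 : F),
        quadSum χ (-s) * charTransform χ (sphereMass χ E) s := by
    rw [← sum_erase_zero_neg_four_mul_inv h2 (charTransform χ (distCount E)), Finset.mul_sum,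
      Finset.mul_sum]
    refine Finset.sum_congr rfl fun s hs => ?_
    have hs0 := Finset.ne_of_mem_erase hs
    have hq' : (q : ℂ) = Fintype.card F := by simp [hq]
    rw [charTransform_sphereMass_of_ne_zero h2 χ E hs0, hq',
      ← hsq (-s) (neg_ne_zero.2 hs0), ← quadSum_mul_quadSum_neg h2 hχ hs0]
    ring
  have hsum : ∑ s ∈ univ.erase (0 : F), quadSum χ (-s) * charTransform χ (sphereMass χ E) s =
      ((∑ t, sphereMass χ E t * (q * ((quadraticChar F t : ℤ) : ℝ)) : ℝ) : ℂ) := by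
    unfold charTransform
    simp_rw [Finset.mul_sum]
    rw [Finset.sum_comm]
    push_cast
    refine Finset.sum_congr rfl fun t _ => ?_
    have := sum_quadSum_mul_addChar h2 hχ t
    rw [hq, Complex.ofReal_natCast, ← this, Finset.mul_sum]
    refine Finset.sum_congr rfl fun s _ => ?_
    ring
  have hbound : |∑ t, sphereMass χ E t * (q * ((quadraticChar F t : ℤ) : ℝ))| ≤
      q * (q ^ (2 * e + 1) * #E) := by
    rw [← sum_sphereMass hχ E, mul_comm q, Finset.sum_mul]
    refine (Finset.abs_sum_le_sum_abs _ _).trans (Finset.sum_le_sum fun t _ => ?_)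
    rw [abs_mul, abs_mul, abs_of_nonneg (sphereMass_nonneg χ E t), abs_of_pos hq0]
    refine mul_le_mul_of_nonneg_left ?_ (sphereMass_nonneg χ E t)
    have : |((quadraticChar F t : ℤ) : ℝ)| ≤ 1 := by
      rcases quadraticChar_isQuadratic F t with h | h | h <;> simp [h]
    nlinarith
  rw [hsum] at key
  have hreal : q ^ (2 * e + 1) * (q * distCount E 0 - (#E : ℝ) ^ 2) =
      (ε * q) ^ e * ∑ t, sphereMass χ E t * (q * ((quadraticChar F t : ℤ) : ℝ)) := by
    have h : (q : ℂ) ^ (2 * e + 1) * ((q : ℂ) * (distCount E 0 : ℂ) - (#E : ℂ) ^ 2) =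
        ((ε : ℂ) * q) ^ e *
          ((∑ t, sphereMass χ E t * (q * ((quadraticChar F t : ℤ) : ℝ)) : ℝ) : ℂ) := by
      rw [← key, hq, Complex.ofReal_natCast, ← hν]
      ring
    exact_mod_cast h
  have habs : |(ε * q) ^ e| = q ^ e := by
    rw [abs_pow, abs_mul, abs_of_pos hq0]
    rcases hε with h | h <;> simp [h]
  have hle : q ^ (2 * e + 1) * (q * distCount E 0 - (#E : ℝ) ^ 2) ≤
      q ^ (2 * e + 1) * (q ^ (e + 1) * #E) := by
    rw [hreal]
    refine (le_abs_self _).trans ?_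
    rw [abs_mul, habs]
    refine (mul_le_mul_of_nonneg_left hbound (by positivity)).trans (le_of_eq ?_)
    ring
  have := le_of_mul_le_mul_left hle (by positivity)
  linarith

/-- The number of quadruples with nonzero distances in ratio `r`. -/
def dilatedCount (E : Finset (Fin d → F)) (r : F) : ℝ :=
  ∑ t ∈ univ.erase (0 : F), distCount E t * distCount E (r * t)

theorem sum_eq_sq_add_dilatedCount (E : Finset (Fin d → F)) (r : F) :
    ∑ t, distCount E t * distCount E (r * t) = distCount E 0 ^ 2 + dilatedCount E r := by
  rw [← Finset.add_sum_erase _ _ (Finset.mem_univ (0 : F)), mul_zero, ← sq, dilatedCount]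

theorem dilatedCount_even (h2 : (2 : F) ≠ 0) {e : ℕ} (E : Finset (Fin (2 * e) → F)) {r : F}
    (hr : r ≠ 0) :
    ((Fintype.card F : ℝ) - 1) * (#E : ℝ) ^ 4
        - ((Fintype.card F : ℝ) + 1) * ((Fintype.card F : ℝ) ^ e) ^ 2 * (#E : ℝ) ^ 2
        - 2 * (Fintype.card F : ℝ) * (Fintype.card F : ℝ) ^ e * (#E : ℝ) ^ 3 ≤
      (Fintype.card F : ℝ) ^ 2 * dilatedCount E r := by
  set χ := AddChar.FiniteField.primitiveChar_to_Complex F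
  have hχ : χ.IsPrimitive := AddChar.FiniteField.primitiveChar_to_Complex_isPrimitive F
  obtain ⟨ε, hε, hsq⟩ := exists_quadSum_sq h2 hχ
  have hε2 : ε ^ 2 = 1 := by rcases hε with h | h <;> simp [h]
  have hκ : ∀ s : F, s ≠ 0 →
      quadSum χ s ^ (2 * e) = (((ε * Fintype.card F) ^ e : ℝ) : ℂ) := by
    intro s hs
    rw [pow_mul, hsq s hs]
    push_cast
    rfl
  have h0 := distCount_zero_even h2 hχ E hκ
  have hmom := dilated_moment_identity h2 hχ E hr (fun s hs => by
    rw [hκ _ (mul_ne_zero (inv_ne_zero hr) hs), hκ _ (neg_ne_zero.2 hs)]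
    have h : (ε * (Fintype.card F : ℝ)) ^ e * (ε * (Fintype.card F : ℝ)) ^ e =
        (Fintype.card F : ℝ) ^ (2 * e) := by
      rw [← mul_pow, pow_mul]
      congr 1
      linear_combination (Fintype.card F : ℝ) ^ 2 * hε2
    rw [← Complex.ofReal_mul, h]
    simp)
  rw [sum_eq_sq_add_dilatedCount] at hmom
  -- The `t = 0` term is kept: it offsets the square of the deviation of `ν(0)`.
  have hW : sphereMass χ E 0 ^ 2 ≤ ∑ t, sphereMass χ E t * sphereMass χ E (r⁻¹ * t) := by
    have := Finset.single_le_sum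
      (f := fun t => sphereMass χ E t * sphereMass χ E (r⁻¹ * t))
      (fun t _ => mul_nonneg (sphereMass_nonneg χ E t) (sphereMass_nonneg χ E _))
      (Finset.mem_univ (0 : F))
    simpa [sq] using this
  have hZ0 := sphereMass_nonneg χ E 0
  have hZ1 : sphereMass χ E 0 ≤ (Fintype.card F : ℝ) ^ (2 * e) * #E := by
    rw [← sum_sphereMass hχ E]
    exact Finset.single_le_sum (fun t _ => sphereMass_nonneg χ E t) (Finset.mem_univ (0 : F))
  have hq1 : (1 : ℝ) ≤ Fintype.card F := by exact_mod_cast Fintype.card_pos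
  set q := (Fintype.card F : ℝ) with hq
  set D : ℝ := q ^ e with hD
  have hD0 : 0 < D := by positivity
  have hq2 : q ^ (2 * e) = D ^ 2 := by rw [hD, ← pow_mul, mul_comm]
  have hεD : (ε * q) ^ e = D ∨ (ε * q) ^ e = -D := by
    rw [mul_pow, ← hD]
    have : ε ^ e = 1 ∨ ε ^ e = -1 := by
      rcases hε with h | h
      · simp [h]
      · rw [h]; exact neg_one_pow_eq_or ℝ e
    rcases this with h | h <;> simp [h]
  rw [hq2] at hmom h0 hZ1
  set Z := sphereMass χ E 0
  set W := ∑ t, sphereMass χ E t * sphereMass χ E (r⁻¹ * t)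
  set N := (#E : ℝ) with hN
  have hN0 : 0 ≤ N := Nat.cast_nonneg _
  set S := dilatedCount E r
  set ν := distCount E 0
  -- the deviation of the number of pairs at distance zero from its mean
  set z := q * Z - D ^ 2 * N with hz
  have hzu : |z| ≤ q * D ^ 2 * N := by
    rw [abs_le, hz]
    have h3 : D ^ 2 * N ≤ q * (D ^ 2 * N) := le_mul_of_one_le_left (by positivity) hq1
    constructor <;> nlinarith [mul_le_mul_of_nonneg_left hZ1 (by linarith : 0 ≤ q)]
  -- Only the cross term is estimated; `z ^ 2` stays exact so as to cancel against `q² Z²`.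
  have hν : (D * (q * ν)) ^ 2 ≤ z ^ 2 + 2 * D * N ^ 2 * (q * D ^ 2 * N) + D ^ 2 * N ^ 4 := by
    have hc : 0 ≤ 2 * D * N ^ 2 := by positivity
    have h5 := mul_le_mul_of_nonneg_left ((le_abs_self z).trans hzu) hc
    have h6 := mul_le_mul_of_nonneg_left ((neg_le_abs z).trans hzu) hc
    rcases hεD with h | h
    · have : D * (q * ν) = z + D * N ^ 2 := by rw [h0, h]; ring
      rw [this]; linarith
    · have : D * (q * ν) = -z + D * N ^ 2 := by rw [h0, h]; ring
      rw [this]; linarith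
  have hW' : q * (q * Z ^ 2) ≤ q * (q * W) := by gcongr
  have hfin : D ^ 2 * ((q - 1) * N ^ 4 - (q + 1) * D ^ 2 * N ^ 2 - 2 * q * D * N ^ 3) ≤
      D ^ 2 * (q ^ 2 * S) := by
    have e1 : D ^ 2 * (q ^ 2 * S) =
        q * (q * W) - q * (D ^ 2 * N) ^ 2 + q * D ^ 2 * N ^ 4 - (D * (q * ν)) ^ 2 := by
      linear_combination -q * hmom
    have e2 : z ^ 2 = q * (q * Z ^ 2) - 2 * q * Z * (D ^ 2 * N) + (D ^ 2 * N) ^ 2 := by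
      rw [hz]; ring
    have e3 : 0 ≤ 2 * q * Z * (D ^ 2 * N) := by positivity
    rw [e1]
    linarith
  exact le_of_mul_le_mul_left hfin (by positivity)

theorem dilatedCount_odd (h2 : (2 : F) ≠ 0) {e : ℕ} (E : Finset (Fin (2 * e + 1) → F)) {r : F}
    (hr : r ≠ 0) (hrs : IsSquare r) :
    (Fintype.card F : ℝ) * (#E : ℝ) ^ 4
        - (Fintype.card F : ℝ) * (Fintype.card F : ℝ) ^ (2 * e + 1) * (#E : ℝ) ^ 2
        - ((#E : ℝ) ^ 2 + (Fintype.card F : ℝ) ^ (e + 1) * #E) ^ 2 ≤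
      (Fintype.card F : ℝ) ^ 2 * dilatedCount E r := by
  set χ := AddChar.FiniteField.primitiveChar_to_Complex F
  have hχ : χ.IsPrimitive := AddChar.FiniteField.primitiveChar_to_Complex_isPrimitive F
  have h0 := distCount_zero_odd h2 hχ E
  have hmom := dilated_moment_identity h2 hχ E hr (fun s hs => by
    obtain ⟨c, hc⟩ := hrs
    have hc0 : c ≠ 0 := by
      rintro rfl
      exact hr (by simpa using hc)
    have : r⁻¹ * s = s * (c⁻¹) ^ 2 := by
      rw [hc, inv_pow, sq, mul_comm]
    rw [this, quadSum_mul_sq χ s (inv_ne_zero hc0), ← mul_pow, quadSum_mul_quadSum_neg h2 hχ hs])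
  rw [sum_eq_sq_add_dilatedCount] at hmom
  have hW : 0 ≤ ∑ t, sphereMass χ E t * sphereMass χ E (r⁻¹ * t) :=
    Finset.sum_nonneg fun t _ => mul_nonneg (sphereMass_nonneg χ E t) (sphereMass_nonneg χ E _)
  have hν0 := distCount_nonneg E 0
  have hq1 : (1 : ℝ) ≤ Fintype.card F := by exact_mod_cast Fintype.card_pos
  set q := (Fintype.card F : ℝ) with hq
  set W := ∑ t, sphereMass χ E t * sphereMass χ E (r⁻¹ * t)
  set N := (#E : ℝ) with hN
  set S := dilatedCount E r
  set ν := distCount E 0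
  set B := q ^ (2 * e + 1) with hB
  have hB0 : 0 < B := by positivity
  have hν : (q * ν) ^ 2 ≤ (N ^ 2 + q ^ (e + 1) * N) ^ 2 := by
    have : 0 ≤ q * ν := by positivity
    gcongr
  have hfin : B * (q * N ^ 4 - q * B * N ^ 2 - (q * ν) ^ 2) ≤ B * (q ^ 2 * S) := by
    have e1 : B * (q ^ 2 * S) =
        q * (q * W) - q * (B * N) ^ 2 + q * B * N ^ 4 - B * (q * ν) ^ 2 := by
      linear_combination -q * hmom
    have : 0 ≤ q * (q * W) := by positivity
    rw [e1]
    linarith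
  have := le_of_mul_le_mul_left hfin hB0
  linarith

end SecondMoment

/-! ### From matchings to stars, and the upper bound -/

section Stars

variable {F : Type*} [Field F] [Fintype F] [DecidableEq F] {d : ℕ}

/-- The size of a largest matching between the neighbourhoods of `x` and of `y` for which
distances from `y` are `r` times distances from `x`. -/
def matchCount (E : Finset (Fin d → F)) (r : F) (x y : Fin d → F) : ℕ :=
  ∑ t ∈ univ.erase (0 : F), min (pinCount E x t) (pinCount E y (r * t))

theorem sqNorm_sub_comm {F : Type*} [Field F] {d : ℕ} (x y : Fin d → F) :
    sqNorm (x - y) = sqNorm (y - x) := by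
  unfold sqNorm
  refine Finset.sum_congr rfl fun i _ => ?_
  simp only [Pi.sub_apply]
  ring

theorem sqNorm_sub_self {F : Type*} [Field F] {d : ℕ} (x : Fin d → F) : sqNorm (x - x) = 0 := by
  simp [sqNorm]

theorem containsPair_of_le_matchCount (E : Finset (Fin d → F)) {r : F} (hr : r ≠ 0) {k : ℕ}
    {x y : Fin d → F} (hx : x ∈ E) (hy : y ∈ E) (hk : k ≤ matchCount E r x y) :
    ContainsPair E (kStar k) r := by
  let n : F → ℕ := fun t => min (pinCount E x t) (pinCount E y (r * t))
  -- The slots `(t, i)` with `t ≠ 0` and `i < n t` number `matchCount E r x y`. Leaves in slots with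
  -- different `t` differ because they lie on different spheres about the centre.
  have hcard : Fintype.card (Fin k) ≤ Fintype.card (Σ t : {t : F // t ≠ 0}, Fin (n t)) := by
    rw [Fintype.card_sigma]
    simp only [Fintype.card_fin]
    refine hk.trans (le_of_eq ?_)
    exact Finset.sum_subtype (univ.erase (0 : F)) (by simp) n
  obtain ⟨φ⟩ := Function.Embedding.nonempty_of_card_le hcard
  have ha : ∀ t : F, Nonempty (Fin (n t) ↪ {z // z ∈ {z ∈ E | sqNorm (x - z) = t}}) := fun t =>
    Function.Embedding.nonempty_of_card_le (by
      rw [Fintype.card_fin, Fintype.card_coe]; exact min_le_left _ _)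
  have hb : ∀ t : F, Nonempty (Fin (n t) ↪ {z // z ∈ {z ∈ E | sqNorm (y - z) = r * t}}) :=
    fun t => Function.Embedding.nonempty_of_card_le (by
      rw [Fintype.card_fin, Fintype.card_coe]; exact min_le_right _ _)
  let a := fun t => (ha t).some
  let b := fun t => (hb t).some
  let u : Fin k → Fin d → F := fun i => (a (φ i).1 (φ i).2).1
  let v : Fin k → Fin d → F := fun i => (b (φ i).1 (φ i).2).1
  have hu : ∀ i, u i ∈ E ∧ sqNorm (x - u i) = (φ i).1 := fun i =>
    Finset.mem_filter.1 (a (φ i).1 (φ i).2).2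
  have hv : ∀ i, v i ∈ E ∧ sqNorm (y - v i) = r * (φ i).1 := fun i =>
    Finset.mem_filter.1 (b (φ i).1 (φ i).2).2
  have hsig : ∀ (c : ∀ t : F, Fin (n t) → Fin d → F), (∀ t, Function.Injective (c t)) →
      ∀ p q : (Σ t : {t : F // t ≠ 0}, Fin (n t)), p.1 = q.1 → c p.1 p.2 = c q.1 q.2 → p = q := by
    rintro c hc ⟨t, i⟩ ⟨t', j⟩ h1 h2
    obtain rfl : t = t' := h1
    exact congrArg _ (hc _ h2)
  have huinj : Function.Injective u := by
    intro i j hij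
    refine φ.injective (hsig (fun t s => (a t s).1)
      (fun t => Subtype.val_injective.comp (a t).injective) _ _ (Subtype.ext ?_) hij)
    rw [← (hu i).2, ← (hu j).2, hij]
  have hvinj : Function.Injective v := by
    intro i j hij
    refine φ.injective (hsig (fun t s => (b t s).1)
      (fun t => Subtype.val_injective.comp (b t).injective) _ _ (Subtype.ext ?_) hij)
    apply mul_left_cancel₀ hr
    rw [← (hv i).2, ← (hv j).2, hij]
  have hux : ∀ i, u i ≠ x := by
    intro i h
    have := (hu i).2
    rw [h, sqNorm_sub_self] at this
    exact (φ i).1.2 this.symm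
  have hvy : ∀ i, v i ≠ y := by
    intro i h
    have := (hv i).2
    rw [h, sqNorm_sub_self] at this
    exact mul_ne_zero hr (φ i).1.2 this.symm
  have hedge : ∀ i, sqNorm (y - v i) = r * sqNorm (x - u i) ∧ r * sqNorm (x - u i) ≠ 0 := by
    intro i
    rw [(hu i).2, (hv i).2]
    exact ⟨rfl, mul_ne_zero hr (φ i).1.2⟩
  refine ⟨Fin.cons x u, Fin.cons y v, ?_, ?_, ?_, ?_, ?_⟩
  · exact Fin.cons_injective_iff.2 ⟨by rintro ⟨i, hi⟩; exact hux i hi, huinj⟩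
  · exact Fin.cons_injective_iff.2 ⟨by rintro ⟨i, hi⟩; exact hvy i hi, hvinj⟩
  · exact Fin.cases hx fun i => (hu i).1
  · exact Fin.cases hy fun i => (hv i).1
  · intro i j hij
    have hij' : i ≠ j ∧ (i = 0 ∨ j = 0) := by
      simpa [kStar, SimpleGraph.starGraph_adj] using hij
    obtain ⟨hne, rfl | rfl⟩ := hij'
    · obtain ⟨j, rfl⟩ := Fin.exists_succ_eq.2 hne.symm
      simpa using hedge j
    · obtain ⟨i, rfl⟩ := Fin.exists_succ_eq.2 hne
      rw [sqNorm_sub_comm, sqNorm_sub_comm ((Fin.cons x u : Fin (k + 1) → Fin d → F) i.succ)]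
      simpa using hedge i

/-- Cauchy-Schwarz on `min * max`: the matching bound `K` controls the `min` factor, and isosceles
triples control the `max` factor through `max² ≤ a² + b²`. -/
theorem dilatedCount_sq_le (h2 : (2 : F) ≠ 0) (E : Finset (Fin d → F)) {r : F} (hr : r ≠ 0)
    {K : ℝ} (hK : ∀ x ∈ E, ∀ y ∈ E, (matchCount E r x y : ℝ) ≤ K) :
    (Fintype.card F : ℝ) * dilatedCount E r ^ 2 ≤
      2 * K ^ 2 * (#E : ℝ) ^ 4 * ((#E : ℝ) ^ 2 + Fintype.card F * (Fintype.card F : ℝ) ^ d) := by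
  set q := (Fintype.card F : ℝ) with hq
  set N := (#E : ℝ) with hN
  have hq0 : 0 ≤ q := Nat.cast_nonneg _
  let T := ∑ x ∈ E, ∑ t, (pinCount E x t : ℝ) ^ 2
  have hT : q * T ≤ N ^ 3 + q * (q ^ d * N) := sum_sq_pinCount_le h2
    (AddChar.FiniteField.primitiveChar_to_Complex_isPrimitive F) E
  let I := E ×ˢ E ×ˢ univ.erase (0 : F)
  let a : (Fin d → F) × (Fin d → F) × F → ℝ := fun p => pinCount E p.1 p.2.2
  let b : (Fin d → F) × (Fin d → F) × F → ℝ := fun p => pinCount E p.2.1 (r * p.2.2)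
  have hS : dilatedCount E r = ∑ p ∈ I, min (a p) (b p) * max (a p) (b p) := by
    simp_rw [min_mul_max]
    rw [Finset.sum_product, dilatedCount]
    simp_rw [Finset.sum_product]
    simp only [a, b, distCount, Finset.sum_mul_sum]
    rw [Finset.sum_comm]
    exact Finset.sum_congr rfl fun x _ => Finset.sum_comm
  have hmin : ∑ p ∈ I, min (a p) (b p) ^ 2 ≤ K ^ 2 * N ^ 2 := by
    rw [Finset.sum_product]
    simp_rw [Finset.sum_product]
    have : ∀ x ∈ E, ∀ y ∈ E,
        ∑ t ∈ univ.erase (0 : F), min (a (x, y, t)) (b (x, y, t)) ^ 2 ≤ K ^ 2 := by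
      intro x hx y hy
      have h1 : (matchCount E r x y : ℝ) =
          ∑ t ∈ univ.erase (0 : F), min (a (x, y, t)) (b (x, y, t)) := by
        simp [matchCount, a, b]
      have h0 : ∀ t, 0 ≤ min (a (x, y, t)) (b (x, y, t)) := fun t =>
        le_min (Nat.cast_nonneg _) (Nat.cast_nonneg _)
      refine (Finset.sum_sq_le_sq_sum_of_nonneg fun t _ => h0 t).trans ?_
      rw [← h1]
      have := hK x hx y hy
      gcongr
    refine (Finset.sum_le_sum fun x hx => Finset.sum_le_sum fun y hy => this x hx y hy).trans
      (le_of_eq ?_)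
    simp only [Finset.sum_const, nsmul_eq_mul, hN]
    ring
  have hmax : ∑ p ∈ I, max (a p) (b p) ^ 2 ≤ 2 * N * T := by
    have h1 : ∀ p, max (a p) (b p) ^ 2 ≤ a p ^ 2 + b p ^ 2 := by
      intro p
      rcases max_choice (a p) (b p) with h | h <;> rw [h]
      · linarith [sq_nonneg (b p)]
      · linarith [sq_nonneg (a p)]
    refine (Finset.sum_le_sum fun p _ => h1 p).trans ?_
    rw [Finset.sum_add_distrib]
    have ha : ∑ p ∈ I, a p ^ 2 ≤ N * T := by
      rw [Finset.sum_product]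
      simp_rw [Finset.sum_product]
      simp only [a, Finset.sum_const, nsmul_eq_mul, ← Finset.mul_sum]
      refine mul_le_mul_of_nonneg_left (Finset.sum_le_sum fun x _ => ?_) (Nat.cast_nonneg _)
      exact Finset.sum_le_univ_sum_of_nonneg fun t => sq_nonneg _
    have hb : ∑ p ∈ I, b p ^ 2 ≤ N * T := by
      rw [Finset.sum_product]
      simp_rw [Finset.sum_product]
      simp only [b, Finset.sum_const, nsmul_eq_mul]
      refine mul_le_mul_of_nonneg_left (Finset.sum_le_sum fun y _ => ?_) (Nat.cast_nonneg _)
      refine (Finset.sum_le_univ_sum_of_nonneg fun t => sq_nonneg _).trans (le_of_eq ?_)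
      exact Fintype.sum_equiv (Equiv.mulLeft₀ r hr) _ _ fun t => rfl
    linarith
  have hCS : dilatedCount E r ^ 2 ≤ K ^ 2 * N ^ 2 * (2 * N * T) := by
    rw [hS]
    refine (Finset.sum_mul_sq_le_sq_mul_sq _ _ _).trans ?_
    exact mul_le_mul hmin hmax (Finset.sum_nonneg fun _ _ => sq_nonneg _) (by positivity)
  have hN0 : 0 ≤ N := Nat.cast_nonneg _
  calc q * dilatedCount E r ^ 2 ≤ q * (K ^ 2 * N ^ 2 * (2 * N * T)) := by gcongr
    _ = 2 * K ^ 2 * N ^ 3 * (q * T) := by ring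
    _ ≤ 2 * K ^ 2 * N ^ 3 * (N ^ 3 + q * (q ^ d * N)) := by gcongr
    _ = _ := by ring

theorem exists_le_matchCount {E : Finset (Fin d → F)} {r : F} {k : ℕ}
    (h2 : (2 : F) ≠ 0) (hr : r ≠ 0)
    (h : 2 * ((k : ℝ) - 1) ^ 2 * (#E : ℝ) ^ 4 *
        ((#E : ℝ) ^ 2 + Fintype.card F * (Fintype.card F : ℝ) ^ d) <
      (Fintype.card F : ℝ) * dilatedCount E r ^ 2) :
    ∃ x ∈ E, ∃ y ∈ E, k ≤ matchCount E r x y := by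
  by_contra! hcon
  refine absurd h (not_lt.2 (dilatedCount_sq_le h2 E hr fun x hx y hy => ?_))
  have h1 : matchCount E r x y + 1 ≤ k := hcon x hx y hy
  have h2 : ((matchCount E r x y + 1 : ℕ) : ℝ) ≤ k := by exact_mod_cast h1
  push_cast at h2
  linarith

/-! ### Numerical comparison of the two bounds -/

theorem sub_one_le_choose_two {k : ℕ} (hk : 2 ≤ k) : (k : ℝ) - 1 ≤ (k.choose 2 : ℝ) := by
  rw [Nat.cast_choose_two]
  have : (2 : ℝ) ≤ k := by exact_mod_cast hk
  nlinarith

/-- Here `D = q^(d/2)` and `K = k - 1`. After multiplication by `q`, the right side is at least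
`0.49 N^8` and the left at most `0.04 N^8`. -/
theorem even_dimension_bound {q D N K S : ℝ} (hq : 5 ≤ q) (hD : q ≤ D) (hK : 1 ≤ K)
    (hN : (31 + 10 * K) * D ≤ N)
    (hS : (q - 1) * N ^ 4 - (q + 1) * D ^ 2 * N ^ 2 - 2 * q * D * N ^ 3 ≤ q ^ 2 * S) :
    2 * K ^ 2 * N ^ 4 * (N ^ 2 + q * D ^ 2) < q * S ^ 2 := by
  have hD0 : 0 < D := by linarith
  have hN1 : 41 * D ≤ N := by nlinarith
  have hN2 : 10 * (K * D) ≤ N := by nlinarith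
  have hN0 : 0 < N := by nlinarith
  have hlow : q * (7 / 10 * N ^ 4) ≤ q * (q * S) := by
    have h1 : 41 * (q * N ^ 3 * D) ≤ q * N ^ 4 := by
      have := mul_le_mul_of_nonneg_left hN1 (by positivity : 0 ≤ q * N ^ 3)
      nlinarith
    have h2 : 41 ^ 2 * (q * N ^ 2 * D ^ 2) ≤ q * N ^ 4 := by
      have := mul_le_mul_of_nonneg_left (pow_le_pow_left₀ (by positivity) hN1 2)
        (by positivity : 0 ≤ q * N ^ 2)
      nlinarith
    have h3 : 5 * N ^ 4 ≤ q * N ^ 4 := by gcongr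
    have h4 : 5 * (D ^ 2 * N ^ 2) ≤ q * (D ^ 2 * N ^ 2) := by gcongr
    nlinarith
  have hlow' : 7 / 10 * N ^ 4 ≤ q * S := le_of_mul_le_mul_left hlow (by linarith)
  have hsq : (7 / 10 * N ^ 4) ^ 2 ≤ (q * S) ^ 2 := pow_le_pow_left₀ (by positivity) hlow' 2
  have hKq : 100 * (K ^ 2 * q ^ 2) ≤ N ^ 2 := by
    have h1 : 10 * (K * q) ≤ N := by
      have : K * q ≤ K * D := by gcongr
      linarith
    have := pow_le_pow_left₀ (by positivity) h1 2
    nlinarith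
  have hDN : D ^ 2 ≤ N ^ 2 := by
    have : D ≤ N := by linarith
    gcongr
  have hqN : q * N ^ 2 ≤ q ^ 2 * N ^ 2 := by
    have : q ≤ q ^ 2 := by nlinarith
    gcongr
  have hup : q * (2 * K ^ 2 * N ^ 4 * (N ^ 2 + q * D ^ 2)) ≤ 4 / 100 * N ^ 8 := by
    calc q * (2 * K ^ 2 * N ^ 4 * (N ^ 2 + q * D ^ 2))
        = 2 * K ^ 2 * N ^ 4 * (q * N ^ 2 + q ^ 2 * D ^ 2) := by ring
      _ ≤ 2 * K ^ 2 * N ^ 4 * (q ^ 2 * N ^ 2 + q ^ 2 * N ^ 2) := by gcongr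
      _ = 4 / 100 * N ^ 6 * (100 * (K ^ 2 * q ^ 2)) := by ring
      _ ≤ 4 / 100 * N ^ 6 * N ^ 2 := by gcongr
      _ = _ := by ring
  have hpos : 0 < N ^ 8 := by positivity
  refine lt_of_mul_lt_mul_left (a := q) ?_ (by linarith)
  nlinarith

/-- Here `w = √q`, `B = q^((d-1)/2)` and `K = k - 1`. After multiplication by `q`, the comparison is
`0.16 N^8` against `0.1 N^8`. -/
theorem odd_dimension_bound {q w B N K S : ℝ} (hw0 : 0 ≤ w) (hw : w ^ 2 = q) (hq : 3 ≤ q)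
    (hB : q ≤ B) (hK : 1 ≤ K) (hN : (4 + √3 * K) * (w * B) ≤ N)
    (hS : q * N ^ 4 - q * (q * B ^ 2) * N ^ 2 - (N ^ 2 + q * B * N) ^ 2 ≤ q ^ 2 * S) :
    2 * K ^ 2 * N ^ 4 * (N ^ 2 + q * (q * B ^ 2)) < q * S ^ 2 := by
  have h3 : √3 ^ 2 = 3 := Real.sq_sqrt (by norm_num)
  have h3' : (17 / 10 : ℝ) ≤ √3 := Real.le_sqrt_of_sq_le (by norm_num)
  have hw1 : (17 / 10 : ℝ) ≤ w := by nlinarith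
  have hB0 : 0 < B := by linarith
  have hwB : 0 < w * B := by positivity
  have hN1 : 57 / 10 * (w * B) ≤ N := by
    refine le_trans ?_ hN
    gcongr
    nlinarith
  have hN2 : √3 * K * (w * B) ≤ N := by
    refine le_trans ?_ hN
    gcongr
    linarith
  have hN0 : 0 < N := lt_of_lt_of_le (by positivity) hN1
  have hDN : 32 * (q * B ^ 2) ≤ N ^ 2 := by
    have := pow_le_pow_left₀ (by positivity) hN1 2
    rw [← hw]
    nlinarith
  have hlow : q * (4 / 10 * N ^ 4) ≤ q * (q * S) := by
    have e1 : q * N ^ 4 - q * (q * B ^ 2) * N ^ 2 - (N ^ 2 + q * B * N) ^ 2 =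
        (q - 1) * N ^ 4 - 2 * q * (N ^ 2 * (q * B ^ 2)) - 2 * N ^ 3 * (q * B) := by ring
    have e2 : q * (N ^ 2 * (32 * (q * B ^ 2))) ≤ q * (N ^ 2 * N ^ 2) := by gcongr
    have e3 : 969 / 100 * (q * B) ≤ q * N := by
      have h1 : 17 / 10 * (57 / 10 * (w * B)) ≤ w * N := by gcongr
      have h2 := mul_le_mul_of_nonneg_left h1 hw0
      rw [← hw]
      nlinarith
    have e4 : N ^ 3 * (969 / 100 * (q * B)) ≤ N ^ 3 * (q * N) := by gcongr
    have e5 : 3 * N ^ 4 ≤ q * N ^ 4 := by gcongr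
    rw [e1] at hS
    nlinarith
  have hlow' : 4 / 10 * N ^ 4 ≤ q * S := le_of_mul_le_mul_left hlow (by linarith)
  have hsq : (4 / 10 * N ^ 4) ^ 2 ≤ (q * S) ^ 2 := pow_le_pow_left₀ (by positivity) hlow' 2
  -- One factor 3 is `√3 ^ 2`; the other comes from `3 ≤ q`, together with `q ≤ B`.
  have hKq : 9 * (K ^ 2 * q ^ 2) ≤ N ^ 2 := by
    have h1 := pow_le_pow_left₀ (by positivity) hN2 2
    have h2 : (√3 * K * (w * B)) ^ 2 = 3 * K ^ 2 * q * B ^ 2 := by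
      rw [mul_pow, mul_pow, mul_pow, h3, hw]; ring
    have h4 : 3 * K ^ 2 * 3 * q ^ 2 ≤ 3 * K ^ 2 * q * B ^ 2 := by gcongr
    linarith
  have hqN : 3 * (q * N ^ 2) ≤ q ^ 2 * N ^ 2 := by
    have : 3 * q ≤ q ^ 2 := by nlinarith
    nlinarith [sq_nonneg N]
  have hup : q * (2 * K ^ 2 * N ^ 4 * (N ^ 2 + q * (q * B ^ 2))) ≤ 1 / 10 * N ^ 8 := by
    have h1 : q * N ^ 2 + q ^ 2 * (q * B ^ 2) ≤ 2 / 5 * (q ^ 2 * N ^ 2) := by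
      have : q ^ 2 * (32 * (q * B ^ 2)) ≤ q ^ 2 * N ^ 2 := by gcongr
      nlinarith
    calc q * (2 * K ^ 2 * N ^ 4 * (N ^ 2 + q * (q * B ^ 2)))
        = 2 * K ^ 2 * N ^ 4 * (q * N ^ 2 + q ^ 2 * (q * B ^ 2)) := by ring
      _ ≤ 2 * K ^ 2 * N ^ 4 * (2 / 5 * (q ^ 2 * N ^ 2)) := by gcongr
      _ = 4 / 45 * N ^ 6 * (9 * (K ^ 2 * q ^ 2)) := by ring
      _ ≤ 4 / 45 * N ^ 6 * N ^ 2 := by gcongr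
      _ ≤ 1 / 10 * N ^ 8 := by
        have : 0 < N ^ 8 := by positivity
        nlinarith
  have hpos : 0 < N ^ 8 := by positivity
  refine lt_of_mul_lt_mul_left (a := q) ?_ (by linarith)
  nlinarith

end Stars

/-! ### Conclusion in both parities -/

theorem theorem1p5 {F : Type*} [Field F] [Fintype F] (hq : Odd (Fintype.card F))
    (d k : ℕ) (hk : 2 ≤ k) (E : Finset (Fin d → F)) (r : F) :
    (5 ≤ Fintype.card F → 2 ≤ d → Even d → r ≠ 0 →
      (31 + 10 * (Nat.choose k 2 : ℝ)) * (Fintype.card F : ℝ) ^ ((d : ℝ) / 2) ≤ (E.card : ℝ) →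
      ContainsPair E (kStar k) r) ∧
    (3 ≤ d → Odd d → r ≠ 0 → IsSquare r →
      (4 + Real.sqrt 3 * (Nat.choose k 2 : ℝ)) * (Fintype.card F : ℝ) ^ ((d : ℝ) / 2)
        ≤ (E.card : ℝ) →
      ContainsPair E (kStar k) r) := by
  classical
  have h2 := two_ne_zero_of_odd_card hq
  have hK1 : (1 : ℝ) ≤ (k : ℝ) - 1 := by
    have : (2 : ℝ) ≤ k := by exact_mod_cast hk
    linarith
  have hKc := sub_one_le_choose_two hk
  have hq0 : (0 : ℝ) ≤ Fintype.card F := Nat.cast_nonneg _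
  refine ⟨fun hq5 hd hdeven hr hE => ?_, fun hd hdodd hr hrs hE => ?_⟩
  · obtain ⟨e, rfl⟩ := hdeven.two_dvd
    have hq5' : (5 : ℝ) ≤ Fintype.card F := by exact_mod_cast hq5
    have hpow : (Fintype.card F : ℝ) ^ (((2 * e : ℕ) : ℝ) / 2) = (Fintype.card F : ℝ) ^ e := by
      rw [← Real.rpow_natCast]
      congr 1
      push_cast
      ring
    rw [hpow] at hE
    have hD : (Fintype.card F : ℝ) ≤ (Fintype.card F : ℝ) ^ e :=
      le_self_pow₀ (by linarith) (by omega)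
    -- The argument needs only `k - 1` in place of the binomial coefficient.
    have hE' : (31 + 10 * ((k : ℝ) - 1)) * (Fintype.card F : ℝ) ^ e ≤ #E :=
      le_trans (by gcongr) hE
    have hb := even_dimension_bound hq5' hD hK1 hE' (dilatedCount_even h2 E hr)
    rw [← pow_mul, mul_comm e 2] at hb
    obtain ⟨x, hx, y, hy, h⟩ := exists_le_matchCount h2 hr hb
    exact containsPair_of_le_matchCount E hr hx hy h
  · obtain ⟨e, rfl⟩ := hdodd
    have hq3 : 3 ≤ Fintype.card F := by
      have := Fintype.one_lt_card (α := F)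
      obtain ⟨m, hm⟩ := hq
      omega
    have hq3' : (3 : ℝ) ≤ Fintype.card F := by exact_mod_cast hq3
    have hpow : (Fintype.card F : ℝ) ^ (((2 * e + 1 : ℕ) : ℝ) / 2) =
        √(Fintype.card F : ℝ) * (Fintype.card F : ℝ) ^ e := by
      rw [Real.sqrt_eq_rpow, ← Real.rpow_natCast, ← Real.rpow_add (by linarith)]
      congr 1
      push_cast
      ring
    rw [hpow] at hE
    have hB : (Fintype.card F : ℝ) ≤ (Fintype.card F : ℝ) ^ e :=
      le_self_pow₀ (by linarith) (by omega)
    have hE' : (4 + √3 * ((k : ℝ) - 1)) *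
        (√(Fintype.card F : ℝ) * (Fintype.card F : ℝ) ^ e) ≤ #E := le_trans (by gcongr) hE
    have hd' : (Fintype.card F : ℝ) ^ (2 * e + 1) =
        Fintype.card F * ((Fintype.card F : ℝ) ^ e) ^ 2 := by ring
    have hS := dilatedCount_odd h2 E hr hrs
    rw [hd', pow_succ' _ e] at hS
    have hb := odd_dimension_bound (Real.sqrt_nonneg _) (Real.sq_sqrt hq0) hq3' hB hK1 hE' hS
    rw [← hd'] at hb
    obtain ⟨x, hx, y, hy, h⟩ := exists_le_matchCount h2 hr hb
    exact containsPair_of_le_matchCount E hr hx hy h
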